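/- Let $l>-1$ and let $\phi:(0,\infty)\to[0,\infty)$ be $C^1$ such that, for some $k>-1$ and $k'>-2$, $\phi(E)\le \mathrm{const}\,E^{k}$ and $\phi'(E)\le \mathrm{const}\,E^{k'}$ for all sufficiently small $E>0$. For $\omega>0$ put $$g(\omega)=\int_0^\omega \phi(E)\,(\omega-E)^{l+1/2}\,dE ,$$ assume $g(\omega)>0$ for all $\omega>0$, and define $n(\omega)=-l+\dfrac{d\log g}{d\log\omega}(\omega)$. For $\Omega\in(0,1)$ write $n(\Omega)$ for the value of this function at $\omega=\Omega/(1-\Omega)$. Consider the dynamical system $$\begin{aligned} \frac{dU}{d\lambda}&=U(1-U)\big[(1-Q)\big(3+2l-(4+2l)U\big)-(n(\Omega)+l)\,Q(1-U)\big],\\ \frac{dQ}{d\lambda}&=Q(1-Q)\big[(2U-1)(1-Q)+Q(1-U)\big],\\ \frac{d\Omega}{d\lambda}&=-\Omega(1-\Omega)\,Q(1-U). \end{aligned}$$ An interior orbit is a solution $(U,Q,\Omega):\mathbb R\to(0,1)^3$. It originates from a set $A$ if it converges to a point of $A$ as $\lambda\to-\infty$; its $\omega$-limit is its set of limit points in $[0,1]^3$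 as $\lambda\to+\infty$. Let $L_1=\{(1,0,\Omega):0<\Omega<1\}$ and $L_2=\{(\tfrac{3+2l}{4+2l},0,\Omega):0<\Omega<1\}$ (lines of fixed points). Suppose that for some $0<\Omega_0<1$ we have $n(\Omega)\le 5+3l$ for all $0<\Omega\le\Omega_0$, and that $n$ is not identically equal to $5+3l$ on any interval $(0,\delta)$, $\delta>0$. Then the $\omega$-limit of every interior orbit originating from $L_1\cap\{\Omega\le\Omega_0\}$ or $L_2\cap\{\Omega\le\Omega_0\}$ lies on $\{Q=1,\ \Omega=0\}$. If moreover, for some $\varepsilon>0$, $n(\Omega)\ge -l+\varepsilon$ for all sufficiently small $\Omega>0$, then the $\omega$-limit of every such orbit is the point $(U,Q,\Omega)=(0,1,0)$. -/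

import Mathlib

open Set Filter Topology

namespace StaticVlasovPoisson

/-- `g_m(ω) = ∫₀^ω φ(E) (ω - E)^m dE`. Up to the factor `C_l r^{2l}`, the mass density of the
distribution function `f = φ(E) L^{2l}` is `g_{l+1/2}`. -/
noncomputable def g (φ : ℝ → ℝ) (m ω : ℝ) : ℝ :=
  ∫ E in (0 : ℝ)..ω, φ E * (ω - E) ^ m

/-- The regularity conditions on the energy profile `φ` on `(0, ∞)`, together with
`g_{l+1/2} > 0`, without which the polytropic index is undefined. -/
structure IsAdmissible (l : ℝ) (φ : ℝ → ℝ) : Prop where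
  nonneg : ∀ E, 0 < E → 0 ≤ φ E
  contDiffOn : ContDiffOn ℝ 1 φ (Ioi 0)
  growth : ∃ k C : ℝ, -1 < k ∧ ∀ᶠ E in 𝓝[>] (0 : ℝ), φ E ≤ C * E ^ k
  deriv_growth : ∃ k' C' : ℝ, -2 < k' ∧ ∀ᶠ E in 𝓝[>] (0 : ℝ), deriv φ E ≤ C' * E ^ k'
  g_pos : ∀ ω, 0 < ω → 0 < g φ (l + 1 / 2) ω

/-- The polytropic index `n(ω) = -l + d log g_{l+1/2} / d log ω`. -/
noncomputable def polytropicIndex (φ : ℝ → ℝ) (l ω : ℝ) : ℝ :=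
  -l + ω * logDeriv (g φ (l + 1 / 2)) ω

/-- The polytropic index as a function of `Ω = ω / (1 + ω) ∈ (0, 1)`, so that `ω = Ω / (1 - Ω)`. -/
noncomputable def indexOfOmega (φ : ℝ → ℝ) (l Ω : ℝ) : ℝ :=
  polytropicIndex φ l (Ω / (1 - Ω))

/-- The right-hand side of the dynamical system for `(U, Q, Ω)`. -/
noncomputable def vectorField (φ : ℝ → ℝ) (l : ℝ) : ℝ × ℝ × ℝ → ℝ × ℝ × ℝ :=
  fun (U, Q, Ω) =>
    (U * (1 - U) * ((1 - Q) * (3 + 2 * l - (4 + 2 * l) * U)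
        - (indexOfOmega φ l Ω + l) * Q * (1 - U)),
     Q * (1 - Q) * ((2 * U - 1) * (1 - Q) + Q * (1 - U)),
     -Ω * (1 - Ω) * Q * (1 - U))

/-- An interior orbit: a solution, for all times, with values in the open cube `(0, 1)³`. -/
structure IsInteriorOrbit (φ : ℝ → ℝ) (l : ℝ) (γ : ℝ → ℝ × ℝ × ℝ) : Prop where
  mem : ∀ t, γ t ∈ Ioo (0 : ℝ) 1 ×ˢ Ioo (0 : ℝ) 1 ×ˢ Ioo (0 : ℝ) 1
  hasDerivAt : ∀ t, HasDerivAt γ (vectorField φ l (γ t)) t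

/-- The line of fixed points `U = 1, Q = 0`. -/
def L₁ : Set (ℝ × ℝ × ℝ) := {1} ×ˢ {0} ×ˢ Ioo 0 1

/-- The line of fixed points `U = (3 + 2l) / (4 + 2l), Q = 0`. -/
def L₂ (l : ℝ) : Set (ℝ × ℝ × ℝ) := {(3 + 2 * l) / (4 + 2 * l)} ×ˢ {0} ×ˢ Ioo 0 1

/-- The orbit `γ` originates from the set `A`: it converges to a point of `A` as the time tends
to `-∞`. -/
def OriginatesFrom (γ : ℝ → ℝ × ℝ × ℝ) (A : Set (ℝ × ℝ × ℝ)) : Prop :=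
  ∃ p ∈ A, Tendsto γ atBot (𝓝 p)

/-- The `ω`-limit set of the orbit `γ` (taken in `ℝ³`, hence in the closed cube). -/
def omegaLimitSet (γ : ℝ → ℝ × ℝ × ℝ) : Set (ℝ × ℝ × ℝ) :=
  omegaLimit atTop (fun (t : ℝ) (_ : Unit) => γ t) univ

end StaticVlasovPoisson

/-!
Write `u = U / (1 - U)`, `q = Q / (1 - Q)`, `a = 3 + 2 * l` and `N = n + l`, so that the bound
`n ≤ 5 + 3 * l` reads `N ≤ 2 * a - 1`. The argument rests on the function `W = u / a + q - 1`
(`criticalLevel`), which satisfies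
`W' = U * Q * (2 * a - 1 - N) / a + W * (Q - U)`.
For `N = 2 * a - 1` its zero set is invariant: it carries the regular polytropes of infinite radius.
For `N ≤ 2 * a - 1`, multiplication by `exp ∫ (U - Q)` makes `W` monotone, and the behaviour at the
two lines of fixed points gives `W ≥ 0` along the orbits in question
(`IsCoordOrbit.criticalLevel_nonneg`). In the region `W ≥ 0` the variable `Q` increases, with
`Q' ≥ (1 - 1 / a) * Q * (1 - Q) ^ 2 * U` (`IsCoordOrbit.rate_Q_ge`).

The rest is a series of convergence statements. `Ω → 0` (`IsCoordOrbit.tendsto_Ω`), because otherwise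
`N` is bounded below and `U` cannot approach `1`, so that `Ω` keeps decreasing at a definite rate.
Since `n` is not identically `5 + 3 * l` near `0` and `Ω` passes through all small values, `W` is
positive from some time on. Then `Q → 1` (`IsCoordOrbit.tendsto_Q`): while `Q` stays away from `1`,
`W` grows exponentially, which forces `U` and hence `Q'` to be bounded below. If finally `N ≥ ε`
near `Ω = 0`, then `U' ≤ -(ε / 2) * U * (1 - U) ^ 2` eventually, and `U → 0`
(`IsCoordOrbit.tendsto_U`).

The only analytic input on `φ` is that `n` is bounded below on compact subsets of `(0, 1)`
(`IsAdmissible.exists_le_indexOfOmega`). Since only a lower bound is needed, one-sided Lipschitz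
estimates for `g` suffice and differentiability of `g` is never established: where `g` is not
differentiable, `deriv` takes the value `0`, which is consistent with the bound.
-/

namespace StaticVlasovPoisson

/-! ### A lower bound for the polytropic index -/

section Index

open MeasureTheory intervalIntegral

/-- A one-sided Lipschitz bound gives a lower bound on the derivative. Where `f` is not
differentiable, `deriv f x = 0` satisfies the bound as well, because `0 ≤ K`. -/
lemma neg_le_deriv_of_sub_bound {f : ℝ → ℝ} {s : Set ℝ} {K x : ℝ} (hs : IsOpen s) (hK : 0 ≤ K)
    (hx : x ∈ s) (h : ∀ x ∈ s, ∀ y ∈ s, x ≤ y → -K * (y - x) ≤ f y - f x) :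
    -K ≤ deriv f x := by
  by_cases hd : DifferentiableAt ℝ f x
  · have hmono : MonotoneOn (fun z => f z + K * z) s := by
      intro y hy z hz hyz
      have := h y hy z hz hyz
      simp only
      linarith
    have h1 := hmono.derivWithin_nonneg (x := x)
    rw [derivWithin_of_isOpen hs hx] at h1
    have h2 : deriv (fun z => f z + K * z) x = deriv f x + K := by
      have := (hd.hasDerivAt.fun_add ((hasDerivAt_id x).const_mul K)).deriv
      simpa using this
    linarith
  · rw [deriv_zero_of_not_differentiableAt hd]
    linarith

lemma mul_rpow_mul_le_rpow_sub_rpow {m c p q : ℝ} (hm : m ≤ 0) (hc : 0 < c) (hcp : c ≤ p)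
    (hpq : p ≤ q) : m * c ^ (m - 1) * (q - p) ≤ q ^ m - p ^ m := by
  have hd : ∀ x ∈ Ici c, HasDerivAt (fun x : ℝ => x ^ m) (m * x ^ (m - 1)) x := fun x hx =>
    Real.hasDerivAt_rpow_const (Or.inl (hc.trans_le hx).ne')
  refine (convex_Ici c).mul_sub_le_image_sub_of_le_deriv
    (fun x hx => (hd x hx).continuousAt.continuousWithinAt)
    (fun x hx => (hd x (interior_subset hx)).differentiableAt.differentiableWithinAt)
    (fun x hx => ?_) p hcp q (hcp.trans hpq) hpq
  have hx' := interior_subset hx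
  rw [(hd x hx').deriv]
  exact mul_le_mul_of_nonpos_left (Real.rpow_le_rpow_of_nonpos hc hx' (by linarith)) hm

section Density

variable {φ : ℝ → ℝ} {m : ℝ}

/-- Positivity of `g φ m ω` already forces its integrand to be integrable, since the integral of a
non-integrable function is `0`. -/
lemma intervalIntegrable_integrand (hg : ∀ ω, 0 < ω → 0 < g φ m ω) {ω : ℝ} (hω : 0 < ω) :
    IntervalIntegrable (fun E => φ E * (ω - E) ^ m) volume 0 ω :=
  intervalIntegrable_of_integral_ne_zero (hg ω hω).ne'

lemma intervalIntegrable_profile (hg : ∀ ω, 0 < ω → 0 < g φ m ω) {β : ℝ} (hβ : 0 < β) :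
    IntervalIntegrable φ volume 0 β := by
  -- On `[0, β]` the kernel at `ω = β + 1` is continuous and nonvanishing, so it can be divided out.
  have h1 : IntervalIntegrable (fun E => φ E * (β + 1 - E) ^ m) volume 0 β :=
    (intervalIntegrable_integrand hg (by linarith : 0 < β + 1)).mono_set (by
      rw [uIcc_of_le hβ.le, uIcc_of_le (by linarith)]
      exact Icc_subset_Icc_right (by linarith))
  have h2 : ContinuousOn (fun E : ℝ => (β + 1 - E) ^ (-m)) (uIcc 0 β) := by
    rw [uIcc_of_le hβ.le]
    intro E hE
    refine ContinuousAt.continuousWithinAt ?_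
    exact (continuousAt_const.sub continuousAt_id).rpow_const
      (Or.inl (by simp only [Pi.sub_apply, id]; linarith [hE.2]))
  refine (h1.mul_continuousOn h2).congr (fun E hE => ?_)
  rw [uIoc_of_le hβ.le] at hE
  have hpos : 0 < β + 1 - E := by linarith [hE.2]
  rw [mul_assoc, ← Real.rpow_add hpos, add_neg_cancel, Real.rpow_zero, mul_one]

lemma integral_profile_pos (hφ : ∀ E, 0 < E → 0 ≤ φ E) (hg : ∀ ω, 0 < ω → 0 < g φ m ω)
    {α : ℝ} (hα : 0 < α) : 0 < ∫ E in (0 : ℝ)..α, φ E := by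
  have hnn : 0 ≤ᵐ[volume.restrict (Ioc 0 α)] φ :=
    (ae_restrict_mem measurableSet_Ioc).mono fun E hE => hφ E hE.1
  refine lt_of_le_of_ne (integral_nonneg_of_ae_restrict hα.le
    ((ae_restrict_iff' measurableSet_Icc).2 ?_)) fun h0 => ?_
  · filter_upwards [Measure.ae_ne volume (0 : ℝ)] with E hE hE'
    exact hφ E (lt_of_le_of_ne hE'.1 hE.symm)
  have hz := (integral_eq_zero_iff_of_le_of_nonneg_ae hα.le hnn
    (intervalIntegrable_profile hg hα)).1 h0.symm
  have : g φ m α = 0 := by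
    rw [g, integral_of_le hα.le]
    refine integral_eq_zero_of_ae (hz.mono fun E hE => ?_)
    simp only [hE, Pi.zero_apply, zero_mul]
  exact (hg α hα).ne' this

lemma g_monotoneOn (hφ : ∀ E, 0 < E → 0 ≤ φ E) (hm : 0 ≤ m) (hg : ∀ ω, 0 < ω → 0 < g φ m ω) :
    MonotoneOn (g φ m) (Ioi 0) := by
  intro x hx y hy hxy
  have hx : 0 < x := hx
  have hy : 0 < y := hy
  have hiy := intervalIntegrable_integrand hg hy
  calc g φ m x ≤ ∫ E in (0 : ℝ)..x, φ E * (y - E) ^ m := by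
        refine integral_mono_on_of_le_Ioo hx.le (intervalIntegrable_integrand hg hx)
          (hiy.mono_set ?_) fun E hE => ?_
        · rw [uIcc_of_le hx.le, uIcc_of_le hy.le]
          exact Icc_subset_Icc_right hxy
        · exact mul_le_mul_of_nonneg_left
            (Real.rpow_le_rpow (by linarith [hE.2]) (by linarith) hm) (hφ E hE.1)
    _ ≤ g φ m y := by
        refine integral_mono_interval le_rfl hx.le hxy ?_ hiy
        exact (ae_restrict_mem measurableSet_Ioc).mono fun E hE =>
          mul_nonneg (hφ E hE.1) (Real.rpow_nonneg (by linarith [hE.2]) m)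

lemma g_lower_bound (hφ : ∀ E, 0 < E → 0 ≤ φ E) (hm : m ≤ 0) (hg : ∀ ω, 0 < ω → 0 < g φ m ω)
    {α β ω : ℝ} (hα : 0 < α) (hω : ω ∈ Icc α β) :
    β ^ m * ∫ E in (0 : ℝ)..α, φ E ≤ g φ m ω := by
  have hω0 : 0 < ω := hα.trans_le hω.1
  have hi := intervalIntegrable_integrand hg hω0
  calc β ^ m * ∫ E in (0 : ℝ)..α, φ E = ∫ E in (0 : ℝ)..α, φ E * β ^ m := by
        rw [intervalIntegral.integral_mul_const, mul_comm]
    _ ≤ ∫ E in (0 : ℝ)..α, φ E * (ω - E) ^ m := by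
        refine integral_mono_on_of_le_Ioo hα.le
          ((intervalIntegrable_profile hg hα).mul_const _) (hi.mono_set ?_) fun E hE => ?_
        · rw [uIcc_of_le hα.le, uIcc_of_le hω0.le]
          exact Icc_subset_Icc_right hω.1
        · exact mul_le_mul_of_nonneg_left
            (Real.rpow_le_rpow_of_nonpos (by linarith [hE.2, hω.1]) (by linarith [hE.1, hω.2]) hm)
            (hφ E hE.1)
    _ ≤ g φ m ω := by
        refine integral_mono_interval le_rfl hα.le hω.1 ?_ hi
        exact (ae_restrict_mem measurableSet_Ioc).mono fun E hE =>
          mul_nonneg (hφ E hE.1) (Real.rpow_nonneg (by linarith [hE.2]) m)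

/-- The part of `g` coming from energies below a threshold `c` that keeps away from the singularity
of the kernel: there the kernel is Lipschitz in `ω`. -/
lemma low_energy_bound (hφ : ∀ E, 0 < E → 0 ≤ φ E) (hm : m ≤ 0)
    (hg : ∀ ω, 0 < ω → 0 < g φ m ω) {c x y : ℝ} (hc : 0 < c) (hcx : 2 * c ≤ x) (hxy : x ≤ y) :
    m * c ^ (m - 1) * (∫ E in (0 : ℝ)..c, φ E) * (y - x) ≤
      (∫ E in (0 : ℝ)..c, φ E * (y - E) ^ m) - ∫ E in (0 : ℝ)..c, φ E * (x - E) ^ m := by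
  have hi : ∀ z, 2 * c ≤ z → IntervalIntegrable (fun E => φ E * (z - E) ^ m) volume 0 c := by
    intro z hz
    refine (intervalIntegrable_integrand hg (by linarith : 0 < z)).mono_set ?_
    rw [uIcc_of_le hc.le, uIcc_of_le (by linarith)]
    exact Icc_subset_Icc_right (by linarith)
  rw [← integral_sub (hi y (hcx.trans hxy)) (hi x hcx)]
  calc m * c ^ (m - 1) * (∫ E in (0 : ℝ)..c, φ E) * (y - x)
      = ∫ E in (0 : ℝ)..c, φ E * (m * c ^ (m - 1) * (y - x)) := by
        rw [intervalIntegral.integral_mul_const]; ring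
    _ ≤ _ := by
        refine integral_mono_on_of_le_Ioo hc.le ((intervalIntegrable_profile hg hc).mul_const _)
          ((hi y (hcx.trans hxy)).sub (hi x hcx)) fun E hE => ?_
        rw [← mul_sub]
        refine mul_le_mul_of_nonneg_left ?_ (hφ E hE.1)
        have := mul_rpow_mul_le_rpow_sub_rpow hm hc (by linarith [hE.2] : c ≤ x - E)
          (by linarith : x - E ≤ y - E)
        linarith [this]

/-- The part of `g` coming from energies above a threshold `c`: after the substitution `s = ω - E`
the kernel no longer depends on `ω`, and the profile is Lipschitz. -/
lemma high_energy_bound (hφ : ∀ E, 0 < E → 0 ≤ φ E) (hm : -1 < m) {c β x y : ℝ} (hc : 0 < c)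
    {L : NNReal} (hL : LipschitzOnWith L φ (Icc c β)) (hcx : c ≤ x) (hxy : x ≤ y) (hy : y ≤ β) :
    -(L * ∫ s in (0 : ℝ)..β, s ^ m) * (y - x) ≤
      (∫ E in c..y, φ E * (y - E) ^ m) - ∫ E in c..x, φ E * (x - E) ^ m := by
  have hsub : ∀ z, ∫ E in c..z, φ E * (z - E) ^ m = ∫ s in (0 : ℝ)..(z - c), φ (z - s) * s ^ m := by
    intro z
    have := integral_comp_sub_left (a := c) (b := z) (fun s => φ (z - s) * s ^ m) z
    simpa using this
  have hint : ∀ z d, d ≤ z - c → z ≤ β → 0 ≤ d →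
      IntervalIntegrable (fun s => φ (z - s) * s ^ m) volume 0 d := by
    intro z d hd hz hd0
    refine (intervalIntegrable_rpow' hm).continuousOn_mul ?_
    rw [uIcc_of_le hd0]
    refine hL.continuousOn.comp (continuousOn_const.sub continuousOn_id) fun s hs => ?_
    exact ⟨by linarith [hs.2], by linarith [hs.1]⟩
  rw [hsub, hsub]
  have h1 : ∫ s in (0 : ℝ)..(x - c), φ (y - s) * s ^ m ≤
      ∫ s in (0 : ℝ)..(y - c), φ (y - s) * s ^ m := by
    refine integral_mono_interval le_rfl (by linarith) (by linarith) ?_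
      (hint y _ le_rfl hy (by linarith))
    exact (ae_restrict_mem measurableSet_Ioc).mono fun s hs =>
      mul_nonneg (hφ _ (by linarith [hs.2])) (Real.rpow_nonneg hs.1.le m)
  have h2 : -(L * (y - x)) * ∫ s in (0 : ℝ)..(x - c), s ^ m ≤
      (∫ s in (0 : ℝ)..(x - c), φ (y - s) * s ^ m) -
        ∫ s in (0 : ℝ)..(x - c), φ (x - s) * s ^ m := by
    have hiy := hint y (x - c) (by linarith) hy (by linarith)
    have hix := hint x (x - c) le_rfl (hxy.trans hy) (by linarith)
    rw [← integral_sub hiy hix, ← intervalIntegral.integral_const_mul]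
    refine integral_mono_on_of_le_Ioo (by linarith) ((intervalIntegrable_rpow' hm).const_mul _)
      (hiy.sub hix) fun s hs => ?_
    rw [← sub_mul]
    refine mul_le_mul_of_nonneg_right ?_ (Real.rpow_nonneg hs.1.le m)
    have := hL.dist_le_mul (y - s) ⟨by linarith [hs.2], by linarith [hs.1]⟩ (x - s)
      ⟨by linarith [hs.2], by linarith [hs.1]⟩
    rw [Real.dist_eq, Real.dist_eq, sub_sub_sub_cancel_right, abs_of_nonneg (sub_nonneg.2 hxy)]
      at this
    exact (abs_le.1 this).1
  have h3 : ∫ s in (0 : ℝ)..(x - c), s ^ m ≤ ∫ s in (0 : ℝ)..β, s ^ m := by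
    refine integral_mono_interval le_rfl (by linarith) (by linarith) ?_ (intervalIntegrable_rpow' hm)
    exact (ae_restrict_mem measurableSet_Ioc).mono fun s hs => Real.rpow_nonneg hs.1.le m
  have h4 := mul_le_mul_of_nonneg_left h3 (mul_nonneg L.2 (sub_nonneg.2 hxy))
  have h5 : (L : ℝ) * (y - x) * (∫ s in (0 : ℝ)..(x - c), s ^ m) ≤
    L * (y - x) * ∫ s in (0 : ℝ)..β, s ^ m := h4
  linarith

lemma exists_sub_bound (hφ : ∀ E, 0 < E → 0 ≤ φ E) (hφ' : ContDiffOn ℝ 1 φ (Ioi 0))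
    (hm : -1 < m) (hm0 : m ≤ 0) (hg : ∀ ω, 0 < ω → 0 < g φ m ω) {α β : ℝ} (hα : 0 < α)
    (hαβ : α ≤ β) :
    ∃ K, 0 ≤ K ∧ ∀ x ∈ Ioo α β, ∀ y ∈ Ioo α β, x ≤ y → -K * (y - x) ≤ g φ m y - g φ m x := by
  have hc : 0 < α / 2 := by positivity
  obtain ⟨L, hL⟩ := (hφ'.mono fun E (hE : E ∈ Icc (α / 2) β) => mem_Ioi.2 (hc.trans_le hE.1)
    ).exists_lipschitzOnWith one_ne_zero (convex_Icc _ _) isCompact_Icc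
  have hs : 0 ≤ ∫ s in (0 : ℝ)..β, s ^ m :=
    integral_nonneg (by linarith) fun s hs => Real.rpow_nonneg hs.1 m
  have hp := (integral_profile_pos hφ hg hc).le
  refine ⟨-m * (α / 2) ^ (m - 1) * (∫ E in (0 : ℝ)..(α / 2), φ E) + L * ∫ s in (0 : ℝ)..β, s ^ m,
    add_nonneg (mul_nonneg (mul_nonneg (by linarith) (Real.rpow_nonneg hc.le _)) hp)
      (mul_nonneg L.2 hs), fun x hx y hy hxy => ?_⟩
  have hsplit : ∀ z ∈ Ioo α β, g φ m z = (∫ E in (0 : ℝ)..(α / 2), φ E * (z - E) ^ m) +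
      ∫ E in (α / 2)..z, φ E * (z - E) ^ m := by
    intro z hz
    have hz0 : 0 < z := hα.trans hz.1
    have hi := intervalIntegrable_integrand hg hz0
    refine (integral_add_adjacent_intervals (hi.mono_set ?_) (hi.mono_set ?_)).symm
    · rw [uIcc_of_le hc.le, uIcc_of_le hz0.le]
      exact Icc_subset_Icc_right (by linarith [hz.1])
    · rw [uIcc_of_le (by linarith [hz.1]), uIcc_of_le hz0.le]
      exact Icc_subset_Icc_left hc.le
  have h1 := low_energy_bound hφ hm0 hg hc (by linarith [hx.1] : 2 * (α / 2) ≤ x) hxy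
  have h2 := high_energy_bound hφ hm hc hL (by linarith [hx.1] : α / 2 ≤ x) hxy hy.2.le
  rw [hsplit x hx, hsplit y hy]
  linarith

/-- On compact subintervals of `(0, ∞)` the logarithmic derivative of `g` is bounded below. -/
lemma exists_le_mul_logDeriv_g (hφ : ∀ E, 0 < E → 0 ≤ φ E) (hφ' : ContDiffOn ℝ 1 φ (Ioi 0))
    (hm : -1 < m) (hg : ∀ ω, 0 < ω → 0 < g φ m ω) {α β : ℝ} (hα : 0 < α) (hαβ : α ≤ β) :
    ∃ M, ∀ ω ∈ Ioo α β, -M ≤ ω * logDeriv (g φ m) ω := by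
  rcases le_total 0 m with hm0 | hm0
  · refine ⟨0, fun ω hω => ?_⟩
    have hω0 : 0 < ω := hα.trans hω.1
    have hd : -0 ≤ deriv (g φ m) ω :=
      neg_le_deriv_of_sub_bound isOpen_Ioi le_rfl (mem_Ioi.2 hω0) fun x hx y hy hxy => by
        have := g_monotoneOn hφ hm0 hg hx hy hxy
        linarith
    rw [neg_zero] at hd ⊢
    exact mul_nonneg hω0.le (div_nonneg hd (hg ω hω0).le)
  · obtain ⟨K, hK0, hK⟩ := exists_sub_bound hφ hφ' hm hm0 hg hα hαβ
    have hG : 0 < β ^ m * ∫ E in (0 : ℝ)..α, φ E :=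
      mul_pos (Real.rpow_pos_of_pos (hα.trans_le hαβ) m) (integral_profile_pos hφ hg hα)
    refine ⟨β * (K / (β ^ m * ∫ E in (0 : ℝ)..α, φ E)), fun ω hω => ?_⟩
    have hω0 : 0 < ω := hα.trans hω.1
    have hd := neg_le_deriv_of_sub_bound isOpen_Ioo hK0 hω hK
    have hGω := g_lower_bound hφ hm0 hg hα ⟨hω.1.le, hω.2.le⟩
    have h1 : -(K / (β ^ m * ∫ E in (0 : ℝ)..α, φ E)) ≤ logDeriv (g φ m) ω := by
      rw [logDeriv_apply]
      calc -(K / (β ^ m * ∫ E in (0 : ℝ)..α, φ E)) ≤ -(K / g φ m ω) :=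
            neg_le_neg (div_le_div_of_nonneg_left hK0 hG hGω)
        _ = -K / g φ m ω := (neg_div _ _).symm
        _ ≤ _ := div_le_div_of_nonneg_right hd (hg ω hω0).le
    have h2 : 0 ≤ K / (β ^ m * ∫ E in (0 : ℝ)..α, φ E) := div_nonneg hK0 hG.le
    have h3 := mul_le_mul_of_nonneg_left h1 hω0.le
    have h4 := mul_le_mul_of_nonneg_right hω.2.le h2
    linarith

end Density

/-- The index is bounded below on every compact subinterval of `(0, 1)`. -/
lemma IsAdmissible.exists_le_indexOfOmega {l : ℝ} {φ : ℝ → ℝ} (hφ : IsAdmissible l φ)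
    (hl : -1 < l) {α β : ℝ} (hα : 0 < α) (hαβ : α ≤ β) (hβ : β < 1) :
    ∃ M, ∀ Ω ∈ Icc α β, -M ≤ indexOfOmega φ l Ω + l := by
  have hβ' : 0 < 1 - β := by linarith
  -- The bound for `logDeriv` holds on open intervals, hence the margins `α / 2` and `+ 1`.
  have h0 : α / 2 ≤ β / (1 - β) + 1 := by
    have : 0 ≤ β / (1 - β) := div_nonneg (by linarith) hβ'.le
    linarith
  obtain ⟨M, hM⟩ := exists_le_mul_logDeriv_g hφ.nonneg hφ.contDiffOn
    (by linarith : -1 < l + 1 / 2) hφ.g_pos (half_pos hα) h0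
  refine ⟨M, fun Ω hΩ => ?_⟩
  have hΩ1 : 0 < 1 - Ω := by linarith [hΩ.2]
  have := hM (Ω / (1 - Ω)) ⟨?_, ?_⟩
  · rw [indexOfOmega, polytropicIndex]
    linarith
  · rw [lt_div_iff₀ hΩ1]
    nlinarith [hΩ.1]
  · have : Ω / (1 - Ω) ≤ β / (1 - β) := by
      rw [div_le_div_iff₀ hΩ1 hβ']
      nlinarith [hΩ.2]
    linarith

end Index

/-! ### Monotonicity and convergence along orbits -/

lemma monotoneOn_Ici_of_hasDerivAt_nonneg {f f' : ℝ → ℝ} {T : ℝ}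
    (hf : ∀ t, T ≤ t → HasDerivAt f (f' t) t) (h : ∀ t, T ≤ t → 0 ≤ f' t) :
    MonotoneOn f (Ici T) :=
  monotoneOn_of_hasDerivWithinAt_nonneg (convex_Ici T)
    (fun t ht => (hf t ht).continuousAt.continuousWithinAt)
    (fun t ht => (hf t (interior_subset ht)).hasDerivWithinAt)
    fun t ht => h t (interior_subset ht)

lemma tendsto_atTop_of_le_hasDerivAt {f f' : ℝ → ℝ} {T c : ℝ} (hc : 0 < c)
    (hf : ∀ t, T ≤ t → HasDerivAt f (f' t) t) (h : ∀ t, T ≤ t → c ≤ f' t) :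
    Tendsto f atTop atTop := by
  have hmono : MonotoneOn (fun t => f t - c * t) (Ici T) :=
    monotoneOn_Ici_of_hasDerivAt_nonneg (f' := fun t => f' t - c * 1)
      (fun t ht => (hf t ht).sub ((hasDerivAt_id t).const_mul c))
      fun t ht => by linarith [h t ht]
  refine tendsto_atTop_mono' atTop (f₁ := fun t => (f T - c * T) + c * t) ?_
    (tendsto_atTop_add_const_left _ _ (tendsto_id.const_mul_atTop hc))
  filter_upwards [eventually_ge_atTop T] with t ht
  have := hmono self_mem_Ici ht ht
  simp only at this
  linarith

lemma not_bounded_of_le_hasDerivAt {f f' : ℝ → ℝ} {T c b : ℝ} (hc : 0 < c)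
    (hf : ∀ t, T ≤ t → HasDerivAt f (f' t) t) (h : ∀ t, T ≤ t → c ≤ f' t)
    (hb : ∀ t, T ≤ t → f t ≤ b) : False := by
  obtain ⟨t, ht, hT⟩ := (((tendsto_atTop_of_le_hasDerivAt hc hf h).eventually_gt_atTop b).and
    (eventually_ge_atTop T)).exists
  exact (hb t hT).not_gt ht

/-- A solution of the system with values in the open cube, written in coordinates. The index enters
only through its values `N = n + l` along the orbit, and `a = 3 + 2 * l`. -/
structure IsCoordOrbit (a : ℝ) (N U Q Ω : ℝ → ℝ) : Prop where
  U_mem : ∀ t, U t ∈ Ioo (0 : ℝ) 1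
  Q_mem : ∀ t, Q t ∈ Ioo (0 : ℝ) 1
  Ω_mem : ∀ t, Ω t ∈ Ioo (0 : ℝ) 1
  hasDerivAt_U : ∀ t, HasDerivAt U (U t * (1 - U t) *
    ((1 - Q t) * (a - (a + 1) * U t) - N t * Q t * (1 - U t))) t
  hasDerivAt_Q : ∀ t, HasDerivAt Q (Q t * (1 - Q t) *
    ((2 * U t - 1) * (1 - Q t) + Q t * (1 - U t))) t
  hasDerivAt_Ω : ∀ t, HasDerivAt Ω (-Ω t * (1 - Ω t) * Q t * (1 - U t)) t

/-- The function `u / a + q - 1`, where `u = U / (1 - U)` and `q = Q / (1 - Q)`. Its zero set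
carries the regular solutions of the polytrope with `N = 2 * a - 1`, i.e. `n = 5 + 3 * l`. -/
noncomputable def criticalLevel (a U Q : ℝ) : ℝ := U / (a * (1 - U)) + Q / (1 - Q) - 1

lemma criticalLevel_mul {a U Q : ℝ} (ha : 0 < a) (hU : U < 1) (hQ : Q < 1) :
    criticalLevel a U Q * (a * (1 - U) * (1 - Q)) =
      U * (1 - Q) + a * (1 - U) * (2 * Q - 1) := by
  have h1 : (1 - U) ≠ 0 := by linarith
  have h2 : (1 - Q) ≠ 0 := by linarith
  have h3 : a ≠ 0 := ha.ne'
  rw [criticalLevel]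
  field_simp
  ring

lemma one_sub_one_div_pos {a : ℝ} (ha : 1 < a) : 0 < 1 - 1 / a := by
  have : 1 / a < 1 := (div_lt_one (by linarith)).2 ha
  linarith

namespace IsCoordOrbit

variable {a : ℝ} {N U Q Ω : ℝ → ℝ} (h : IsCoordOrbit a N U Q Ω)
include h

lemma hasDerivAt_criticalLevel (ha : 0 < a) (t : ℝ) :
    HasDerivAt (fun t => criticalLevel a (U t) (Q t))
      (U t * Q t * (2 * a - 1 - N t) / a + criticalLevel a (U t) (Q t) * (Q t - U t)) t := by
  have h1 : 1 - U t ≠ 0 := by linarith [(h.U_mem t).2]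
  have h2 : 1 - Q t ≠ 0 := by linarith [(h.Q_mem t).2]
  have h3 : a ≠ 0 := ha.ne'
  have hU := h.hasDerivAt_U t
  have hQ := h.hasDerivAt_Q t
  have := ((hU.div ((hU.const_sub 1).const_mul a) (mul_ne_zero h3 h1)).add
    (hQ.div (hQ.const_sub 1) h2)).sub_const 1
  refine this.congr_deriv ?_
  rw [criticalLevel]
  field_simp
  ring

/-- With the integrating factor `exp ∫ (U - Q)` the critical level becomes monotone as long as
`n ≤ 5 + 3 * l`. -/
lemma monotone_criticalLevel_mul_exp (ha : 0 < a) (hN : ∀ t, N t ≤ 2 * a - 1) :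
    Monotone fun t => criticalLevel a (U t) (Q t) * Real.exp (∫ x in (0 : ℝ)..t, (U x - Q x)) := by
  have hcont : Continuous fun x => U x - Q x :=
    (continuous_iff_continuousAt.2 fun t => (h.hasDerivAt_U t).continuousAt).sub
      (continuous_iff_continuousAt.2 fun t => (h.hasDerivAt_Q t).continuousAt)
  refine monotone_of_hasDerivAt_nonneg (fun t => (h.hasDerivAt_criticalLevel ha t).mul
    (hcont.integral_hasStrictDerivAt 0 t).hasDerivAt.exp) fun t => ?_
  have h1 := (h.U_mem t).1
  have h2 := (h.Q_mem t).1
  have h3 : 0 ≤ 2 * a - 1 - N t := by linarith [hN t]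
  have h4 : 0 ≤ U t * Q t * (2 * a - 1 - N t) / a *
      Real.exp (∫ x in (0 : ℝ)..t, (U x - Q x)) := by positivity
  simp only [Pi.zero_apply]
  linarith

/-- On an orbit coming from one of the two lines of fixed points the critical level is nonnegative:
a negative value would be amplified backwards in time by the integrating factor, whereas the level
tends to `0` at the line `u = a` and to `∞` at the line `U = 1`. -/
lemma criticalLevel_nonneg (ha : 0 < a) (hN : ∀ t, N t ≤ 2 * a - 1) {U₀ : ℝ}
    (hU₀ : U₀ = 1 ∨ U₀ = a / (a + 1)) (hU : Tendsto U atBot (𝓝 U₀))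
    (hQ : Tendsto Q atBot (𝓝 0)) (t : ℝ) : 0 ≤ criticalLevel a (U t) (Q t) := by
  by_contra! hneg
  have hmono := h.monotone_criticalLevel_mul_exp ha hN
  have hcont : Continuous fun x => U x - Q x :=
    (continuous_iff_continuousAt.2 fun t => (h.hasDerivAt_U t).continuousAt).sub
      (continuous_iff_continuousAt.2 fun t => (h.hasDerivAt_Q t).continuousAt)
  have hU₀pos : 0 < U₀ := by rcases hU₀ with rfl | rfl <;> positivity
  have hlim : Tendsto (fun t => U t - Q t) atBot (𝓝 U₀) := by simpa using hU.sub hQ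
  obtain ⟨T, hT⟩ := eventually_atBot.1 (hlim.eventually_const_lt hU₀pos)
  set I : ℝ → ℝ := fun t => ∫ x in (0 : ℝ)..t, (U x - Q x) with hI
  set T' := min T t with hT'
  have hIle : ∀ s ≤ T', I s ≤ I T' := by
    intro s hs
    have h1 : I s + ∫ x in s..T', (U x - Q x) = I T' :=
      intervalIntegral.integral_add_adjacent_intervals (hcont.intervalIntegrable _ _)
        (hcont.intervalIntegrable _ _)
    have h2 : 0 ≤ ∫ x in s..T', (U x - Q x) :=
      intervalIntegral.integral_nonneg hs fun x hx => (hT x (hx.2.trans (min_le_left _ _))).le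
    linarith
  obtain ⟨c, hc, hcle⟩ : ∃ c > 0, ∀ s ≤ T', criticalLevel a (U s) (Q s) ≤ -c := by
    refine ⟨-criticalLevel a (U t) (Q t) * Real.exp (I t) / Real.exp (I T'), ?_, fun s hs => ?_⟩
    · have : 0 < -criticalLevel a (U t) (Q t) := by linarith
      positivity
    · have h1 := hmono (hs.trans (min_le_right _ _))
      have h2 := Real.exp_le_exp.2 (hIle s hs)
      have h3 := Real.exp_pos (I s)
      have h4 : criticalLevel a (U t) (Q t) * Real.exp (I t) < 0 :=
        mul_neg_of_neg_of_pos hneg (Real.exp_pos _)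
      have h5 : criticalLevel a (U s) (Q s) * Real.exp (I s) ≤
        criticalLevel a (U t) (Q t) * Real.exp (I t) := h1
      have h6 : criticalLevel a (U s) (Q s) < 0 := by
        by_contra! hcon
        have := mul_nonneg hcon h3.le
        linarith
      rw [neg_mul, neg_div, neg_neg, le_div_iff₀ (Real.exp_pos _)]
      nlinarith
  -- Multiplying by `a * (1 - U) * (1 - Q)` clears denominators; both sides have limits at `-∞`.
  have hle : ∀ᶠ s in atBot, U s * (1 - Q s) + a * (1 - U s) * (2 * Q s - 1) ≤
      -c * (a * (1 - U s) * (1 - Q s)) := by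
    filter_upwards [eventually_le_atBot T'] with s hs
    rw [← criticalLevel_mul ha (h.U_mem s).2 (h.Q_mem s).2]
    refine mul_le_mul_of_nonneg_right (hcle s hs) ?_
    have h1 := (h.U_mem s).2
    have h2 := (h.Q_mem s).2
    exact mul_nonneg (mul_nonneg ha.le (by linarith)) (by linarith)
  have hfin : U₀ * (1 - 0) + a * (1 - U₀) * (2 * 0 - 1) ≤ -c * (a * (1 - U₀) * (1 - 0)) :=
    le_of_tendsto_of_tendsto
      ((hU.mul (hQ.const_sub 1)).add (((hU.const_sub 1).const_mul a).mul
        ((hQ.const_mul 2).sub_const 1)))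
      ((((hU.const_sub 1).const_mul a).mul (hQ.const_sub 1)).const_mul (-c)) hle
  rcases hU₀ with rfl | rfl
  · norm_num at hfin
  · have h1 : 1 - a / (a + 1) = 1 / (a + 1) := by field_simp; ring
    rw [h1] at hfin
    have h2 : a / (a + 1) * (1 - 0) + a * (1 / (a + 1)) * (2 * 0 - 1) = 0 := by ring
    rw [h2] at hfin
    have h3 : 0 < c * (a * (1 / (a + 1)) * (1 - 0)) := by
      rw [sub_zero]
      positivity
    linarith

lemma rate_Q_ge (ha : 1 < a) {t : ℝ} (hW : 0 ≤ criticalLevel a (U t) (Q t)) :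
    (1 - 1 / a) * U t * (1 - Q t) ≤ (2 * U t - 1) * (1 - Q t) + Q t * (1 - U t) := by
  have ha0 : 0 < a := by linarith
  obtain ⟨hU0, hU1⟩ := h.U_mem t
  obtain ⟨hQ0, hQ1⟩ := h.Q_mem t
  have hpos : 0 ≤ a * (1 - U t) * (1 - Q t) :=
    mul_nonneg (mul_nonneg ha0.le (by linarith)) (by linarith)
  have hP := mul_nonneg hW hpos
  rw [criticalLevel_mul ha0 hU1 hQ1] at hP
  have h1 : 0 ≤ (U t * (1 - Q t) + a * (1 - U t) * (2 * Q t - 1)) / a := div_nonneg hP ha0.le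
  have h2 : (U t * (1 - Q t) + a * (1 - U t) * (2 * Q t - 1)) / a =
      1 / a * U t * (1 - Q t) + (1 - U t) * (2 * Q t - 1) := by
    field_simp
  rw [h2] at h1
  linarith

lemma monotone_Q (ha : 1 < a) (hW : ∀ t, 0 ≤ criticalLevel a (U t) (Q t)) : Monotone Q := by
  refine monotone_of_hasDerivAt_nonneg h.hasDerivAt_Q fun t => ?_
  obtain ⟨hU0, hU1⟩ := h.U_mem t
  obtain ⟨hQ0, hQ1⟩ := h.Q_mem t
  have h1 : 0 < 1 - Q t := by linarith
  have h2 := one_sub_one_div_pos ha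
  have h3 := h.rate_Q_ge ha (hW t)
  have h4 : 0 ≤ (1 - 1 / a) * U t * (1 - Q t) := by positivity
  exact mul_nonneg (by positivity) (h4.trans h3)

lemma antitone_Ω : Antitone Ω := by
  refine antitone_of_hasDerivAt_nonpos h.hasDerivAt_Ω fun t => ?_
  have h1 := (h.Ω_mem t).1
  have h2 : 0 < 1 - Ω t := by linarith [(h.Ω_mem t).2]
  have h3 := (h.Q_mem t).1
  have h4 : 0 < 1 - U t := by linarith [(h.U_mem t).2]
  have : 0 ≤ Ω t * (1 - Ω t) * Q t * (1 - U t) := by positivity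
  simp only [Pi.zero_apply]
  linarith

/-- If `Ω` stayed above some `α > 0`, then `N` would be bounded below and
`log (1 - U) - K * Ω` would increase for large `K`. This keeps `1 - U` away from `0`, so that `Ω`
would decrease at a definite rate forever. -/
lemma tendsto_Ω (ha : 0 < a) (hQ : Monotone Q)
    (hN : ∀ α > 0, ∃ M, ∀ t, α ≤ Ω t → -M ≤ N t) : Tendsto Ω atTop (𝓝 0) := by
  have hbdd : BddBelow (range Ω) := ⟨0, by rintro _ ⟨t, rfl⟩; exact (h.Ω_mem t).1.le⟩
  have hlim := tendsto_atTop_ciInf h.antitone_Ω hbdd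
  set α := ⨅ t, Ω t
  have hα : 0 ≤ α := le_ciInf fun t => (h.Ω_mem t).1.le
  rcases hα.eq_or_lt with h0 | hα
  · rwa [← h0] at hlim
  exfalso
  have hαle : ∀ t, α ≤ Ω t := fun t => ciInf_le hbdd t
  obtain ⟨M₀, hM₀⟩ := hN α hα
  obtain ⟨M, hM, hM0⟩ : ∃ M, (∀ t, -M ≤ N t) ∧ 0 ≤ M :=
    ⟨max M₀ 0, fun t => by linarith [hM₀ t (hαle t), le_max_left M₀ 0], le_max_right _ _⟩
  have hΩ0 : 0 < 1 - Ω 0 := by linarith [(h.Ω_mem 0).2]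
  have hQ0 := (h.Q_mem 0).1
  have hrate : ∀ t, 0 ≤ t → α * (1 - Ω 0) * Q 0 * (1 - U t) ≤
      Ω t * (1 - Ω t) * Q t * (1 - U t) := by
    intro t ht
    have h1 := h.antitone_Ω ht
    have h2 := hQ ht
    have h3 := hαle t
    have h4 : 0 ≤ 1 - U t := by linarith [(h.U_mem t).2]
    have h5 : 0 ≤ 1 - Ω t := by linarith
    have h6 := (h.Ω_mem t).1.le
    gcongr
  set κ := α * (1 - Ω 0) * Q 0 with hκ
  have hκ0 : 0 < κ := by positivity
  set K := (a + 1 + M) / κ with hK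
  have hK0 : 0 < K := by positivity
  have hmono : MonotoneOn (fun t => Real.log (1 - U t) - K * Ω t) (Ici 0) := by
    refine monotoneOn_Ici_of_hasDerivAt_nonneg (fun t _ =>
      (((h.hasDerivAt_U t).const_sub 1).log (by linarith [(h.U_mem t).2])).sub
        ((h.hasDerivAt_Ω t).const_mul K)) fun t ht => ?_
    obtain ⟨hU0, hU1⟩ := h.U_mem t
    obtain ⟨hq0, hq1⟩ := h.Q_mem t
    have hU1' : 0 < 1 - U t := by linarith
    have h1 : -(U t * (1 - U t) * ((1 - Q t) * (a - (a + 1) * U t) - N t * Q t * (1 - U t))) /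
        (1 - U t) = U t * (N t * Q t * (1 - U t) - (1 - Q t) * (a - (a + 1) * U t)) := by
      field_simp
      ring
    rw [h1]
    have h2 : -(M * (1 - U t)) ≤ U t * Q t * (N t) * (1 - U t) := by
      have e1 : 0 ≤ U t * Q t := by positivity
      have e2 : U t * Q t ≤ 1 := mul_le_one₀ hU1.le hq0.le hq1.le
      have e3 := mul_le_mul_of_nonneg_left (hM t) e1
      have e4 := mul_le_mul_of_nonneg_right e2 hM0
      have e5 : -M ≤ U t * Q t * N t := by linarith
      have := mul_le_mul_of_nonneg_right e5 hU1'.le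
      linarith
    have h3 : U t * ((1 - Q t) * (a - (a + 1) * U t)) ≤ (a + 1) * (1 - U t) := by
      have e1 : U t * (1 - Q t) ≤ 1 := mul_le_one₀ hU1.le (by linarith) (by linarith)
      have e2 : 0 ≤ U t * (1 - Q t) := mul_nonneg hU0.le (by linarith)
      have e3 : 0 ≤ (a + 1) * (1 - U t) := by positivity
      have e4 := mul_le_mul_of_nonneg_right e1 e3
      nlinarith
    have h4 := mul_le_mul_of_nonneg_left (hrate t ht) hK0.le
    have h5 : K * (κ * (1 - U t)) = (a + 1 + M) * (1 - U t) := by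
      rw [hK]; field_simp
    rw [h5] at h4
    nlinarith
  set c := Real.exp (Real.log (1 - U 0) - K * Ω 0) with hc
  have hcU : ∀ t, 0 ≤ t → c ≤ 1 - U t := by
    intro t ht
    have hU1' : 0 < 1 - U t := by linarith [(h.U_mem t).2]
    rw [← Real.exp_log hU1', hc]
    refine Real.exp_le_exp.2 ?_
    have h1 := hmono self_mem_Ici ht ht
    simp only at h1
    have h2 : 0 ≤ K * Ω t := mul_nonneg hK0.le (h.Ω_mem t).1.le
    linarith
  refine not_bounded_of_le_hasDerivAt (T := 0) (b := 0) (c := κ * c) (mul_pos hκ0 (Real.exp_pos _))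
    (fun t _ => (h.hasDerivAt_Ω t).neg) (fun t ht => ?_)
    (fun t _ => by simp only [Pi.neg_apply]; linarith [(h.Ω_mem t).1])
  have h1 := mul_le_mul_of_nonneg_left (hcU t ht) hκ0.le
  have h2 := hrate t ht
  linarith

/-- If the critical level vanished identically, then so would its derivative, i.e. `N = 2 * a - 1`
along the whole orbit. -/
lemma exists_criticalLevel_pos (ha : 0 < a) (hW : ∀ t, 0 ≤ criticalLevel a (U t) (Q t))
    (hne : ∃ t, N t ≠ 2 * a - 1) : ∃ t, 0 < criticalLevel a (U t) (Q t) := by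
  by_contra! hcon
  obtain ⟨t, ht⟩ := hne
  have hz : (fun t => criticalLevel a (U t) (Q t)) = fun _ => 0 :=
    funext fun t => le_antisymm (hcon t) (hW t)
  have h1 := h.hasDerivAt_criticalLevel ha t
  rw [hz] at h1
  have h2 := h1.unique (hasDerivAt_const t 0)
  rw [show criticalLevel a (U t) (Q t) = 0 from congrFun hz t, zero_mul, add_zero] at h2
  have h3 := (h.U_mem t).1
  have h4 := (h.Q_mem t).1
  have h5 : 2 * a - 1 - N t = 0 := by
    rcases div_eq_zero_iff.1 h2 with h6 | h6
    · rcases mul_eq_zero.1 h6 with h7 | h7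
      · exact absurd h7 (by positivity)
      · exact h7
    · exact absurd h6 ha.ne'
  exact ht (by linarith)

/-- Suppose `Q` stayed below some `b < 1`, so that `Q' ≥ k * U`. Writing `W` for the critical level,
`log W + Q / k` then grows at least at the rate `(Q - U) + U = Q`, hence `W → ∞`. As `q` is
bounded, this means `u → ∞`, so that `U`, and with it `Q'`, is bounded below, which is absurd. -/
lemma tendsto_Q (ha : 1 < a) (hN : ∀ t, N t ≤ 2 * a - 1)
    (hW : ∀ t, 0 ≤ criticalLevel a (U t) (Q t)) (hpos : ∃ t, 0 < criticalLevel a (U t) (Q t)) :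
    Tendsto Q atTop (𝓝 1) := by
  have ha0 : 0 < a := by linarith
  have hmono := h.monotone_Q ha hW
  have hbdd : BddAbove (range Q) := ⟨1, by rintro _ ⟨t, rfl⟩; exact (h.Q_mem t).2.le⟩
  have hlim := tendsto_atTop_ciSup hmono hbdd
  set b := ⨆ t, Q t
  have hb : b ≤ 1 := ciSup_le fun t => (h.Q_mem t).2.le
  rcases hb.eq_or_lt with h0 | hb
  · rwa [h0] at hlim
  exfalso
  have hQb : ∀ t, Q t ≤ b := fun t => le_ciSup hbdd t
  obtain ⟨T, hT⟩ := hpos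
  have hQT := (h.Q_mem T).1
  have hc := one_sub_one_div_pos ha
  have hb' : 0 < 1 - b := by linarith
  set k := Q T * (1 - b) * ((1 - 1 / a) * (1 - b)) with hk
  have hk0 : 0 < k := by positivity
  have hrate : ∀ t, T ≤ t → k * U t ≤
      Q t * (1 - Q t) * ((2 * U t - 1) * (1 - Q t) + Q t * (1 - U t)) := by
    intro t ht
    have h1 := hmono ht
    have h2 := hQb t
    have h3 := (h.U_mem t).1
    have h4 : 0 < 1 - Q t := by linarith
    have h5 := (h.Q_mem t).1
    calc k * U t = Q T * (1 - b) * ((1 - 1 / a) * U t * (1 - b)) := by rw [hk]; ring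
      _ ≤ Q t * (1 - Q t) * ((1 - 1 / a) * U t * (1 - Q t)) := by gcongr
      _ ≤ _ := mul_le_mul_of_nonneg_left (h.rate_Q_ge ha (hW t)) (by positivity)
  have hWpos : ∀ t, T ≤ t → 0 < criticalLevel a (U t) (Q t) := by
    intro t ht
    have h1 := h.monotone_criticalLevel_mul_exp ha0 hN ht
    have h2 := mul_pos hT (Real.exp_pos (∫ x in (0 : ℝ)..T, (U x - Q x)))
    exact pos_of_mul_pos_left (h2.trans_le h1) (Real.exp_pos _).le
  have hlog : Tendsto (fun t => Real.log (criticalLevel a (U t) (Q t)) + 1 / k * Q t)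
      atTop atTop := by
    refine tendsto_atTop_of_le_hasDerivAt (T := T) hQT (fun t ht =>
      ((h.hasDerivAt_criticalLevel ha0 t).log (hWpos t ht).ne').add
        ((h.hasDerivAt_Q t).const_mul (1 / k))) fun t ht => ?_
    have h1 : 0 ≤ U t * Q t * (2 * a - 1 - N t) / a / criticalLevel a (U t) (Q t) := by
      have e1 := (h.U_mem t).1
      have e2 := (h.Q_mem t).1
      have e3 : 0 ≤ 2 * a - 1 - N t := by linarith [hN t]
      have e4 := hW t
      positivity
    rw [add_div, mul_div_cancel_left₀ _ (hWpos t ht).ne']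
    have h2 := mul_le_mul_of_nonneg_left (hrate t ht) (by positivity : 0 ≤ 1 / k)
    have h3 : 1 / k * (k * U t) = U t := by field_simp
    have h4 := hmono ht
    linarith
  have hWtop : ∀ᶠ t in atTop, 1 ≤ criticalLevel a (U t) (Q t) - b / (1 - b) + 1 := by
    filter_upwards [hlog.eventually_ge_atTop (Real.log (b / (1 - b) + 1) + 1 / k),
      eventually_ge_atTop T] with t ht htT
    have h1 : 1 / k * Q t ≤ 1 / k * 1 :=
      mul_le_mul_of_nonneg_left (h.Q_mem t).2.le (by positivity)
    have hb0 : 0 < b := hQT.trans_le (hQb T)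
    have h2 : Real.log (b / (1 - b) + 1) ≤ Real.log (criticalLevel a (U t) (Q t)) := by linarith
    have h3 := (Real.log_le_log_iff (by positivity) (hWpos t htT)).1 h2
    linarith
  obtain ⟨S, hS⟩ := eventually_atTop.1 (hWtop.and (eventually_ge_atTop T))
  refine not_bounded_of_le_hasDerivAt (T := S) (b := 1) (c := k * (1 / 2)) (by positivity)
    (fun t _ => h.hasDerivAt_Q t) (fun t ht => ?_) (fun t _ => (h.Q_mem t).2.le)
  obtain ⟨h1, h2⟩ := hS t ht
  refine le_trans (mul_le_mul_of_nonneg_left ?_ hk0.le) (hrate t h2)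
  have hU1 : 0 < 1 - U t := by linarith [(h.U_mem t).2]
  have hQ1 : 0 < 1 - Q t := by linarith [(h.Q_mem t).2]
  have h3 : Q t / (1 - Q t) ≤ b / (1 - b) := by
    rw [div_le_div_iff₀ hQ1 hb']
    linarith [hQb t]
  rw [criticalLevel] at h1
  have h4 : 1 ≤ U t / (a * (1 - U t)) := by linarith
  rw [le_div_iff₀ (by positivity)] at h4
  have h5 : 1 * (1 - U t) ≤ a * (1 - U t) := mul_le_mul_of_nonneg_right ha.le hU1.le
  linarith

/-- Once `Q` is close to `1`, a positive lower bound on `N` gives `U' ≤ -k * U * (1 - U) ^ 2`. -/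
lemma tendsto_U (hQ : Tendsto Q atTop (𝓝 1)) {ε : ℝ} (hε : 0 < ε)
    (hN : ∀ᶠ t in atTop, ε ≤ N t) : Tendsto U atTop (𝓝 0) := by
  have hQ' : Tendsto (fun t => ε * Q t - (a + 1) * (1 - Q t)) atTop (𝓝 ε) := by
    have := (hQ.const_mul ε).sub ((hQ.const_sub 1).const_mul (a + 1))
    simpa using this
  obtain ⟨T, hT⟩ := eventually_atTop.1
    ((hQ'.eventually_const_lt (half_lt_self hε)).and hN)
  have hrate : ∀ t, T ≤ t → U t * (1 - U t) *
      ((1 - Q t) * (a - (a + 1) * U t) - N t * Q t * (1 - U t)) ≤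
      -(ε / 2 * (U t * (1 - U t) ^ 2)) := by
    intro t ht
    obtain ⟨h1, h2⟩ := hT t ht
    obtain ⟨hU0, hU1⟩ := h.U_mem t
    obtain ⟨hQ0, hQ1⟩ := h.Q_mem t
    have hU1' : 0 < 1 - U t := by linarith
    have e1 : ε * Q t * (1 - U t) ≤ N t * Q t * (1 - U t) := by gcongr
    have e2 : (1 - Q t) * (a - (a + 1) * U t) ≤ (1 - Q t) * ((a + 1) * (1 - U t)) :=
      mul_le_mul_of_nonneg_left (by linarith) (by linarith)
    have e3 := mul_le_mul_of_nonneg_right h1.le hU1'.le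
    have e4 : (1 - Q t) * (a - (a + 1) * U t) - N t * Q t * (1 - U t) ≤
        -(ε / 2 * (1 - U t)) := by linarith
    have e5 := mul_le_mul_of_nonneg_left e4 (by positivity : 0 ≤ U t * (1 - U t))
    linarith
  have hanti : ∀ s t, T ≤ s → s ≤ t → U t ≤ U s := by
    intro s t hs hst
    have := monotoneOn_Ici_of_hasDerivAt_nonneg (T := T) (fun t _ => (h.hasDerivAt_U t).neg)
      (fun t ht => by
        have h1 := hrate t ht
        have h2 := (h.U_mem t).1
        have h3 : 0 ≤ ε / 2 * (U t * (1 - U t) ^ 2) := by positivity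
        linarith) hs (hs.trans hst : T ≤ t) hst
    simpa using this
  refine tendsto_order.2 ⟨fun c hc => Eventually.of_forall fun t => hc.trans (h.U_mem t).1,
    fun c hc => ?_⟩
  by_contra hcon
  have hge : ∀ t, T ≤ t → c ≤ U t := by
    intro t ht
    by_contra! hlt
    exact hcon (eventually_atTop.2 ⟨t, fun s hs => (hanti t s ht hs).trans_lt hlt⟩)
  have hUT : 0 < 1 - U T := by linarith [(h.U_mem T).2]
  refine not_bounded_of_le_hasDerivAt (T := T) (b := 0) (c := ε / 2 * (c * (1 - U T) ^ 2))
    (by positivity) (fun t _ => (h.hasDerivAt_U t).neg) (fun t ht => ?_)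
    (fun t _ => by simp only [Pi.neg_apply]; linarith [(h.U_mem t).1])
  have h1 := hrate t ht
  have h2 := hge t ht
  have h3 := hanti T t le_rfl ht
  have h5 := (h.U_mem t).1.le
  have h4 : ε / 2 * (c * (1 - U T) ^ 2) ≤ ε / 2 * (U t * (1 - U t) ^ 2) := by gcongr
  linarith

end IsCoordOrbit

/-! ### Orbits and limit sets in the cube -/

lemma IsInteriorOrbit.isCoordOrbit {φ : ℝ → ℝ} {l : ℝ} {γ : ℝ → ℝ × ℝ × ℝ}
    (hγ : IsInteriorOrbit φ l γ) :
    IsCoordOrbit (3 + 2 * l) (fun t => indexOfOmega φ l (γ t).2.2 + l) (fun t => (γ t).1)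
      (fun t => (γ t).2.1) (fun t => (γ t).2.2) where
  U_mem t := (hγ.mem t).1
  Q_mem t := (hγ.mem t).2.1
  Ω_mem t := (hγ.mem t).2.2
  hasDerivAt_U t := (hasFDerivAt_fst.comp_hasDerivAt t (hγ.hasDerivAt t)).congr_deriv <| by
    change (γ t).1 * (1 - (γ t).1) * ((1 - (γ t).2.1) * (3 + 2 * l - (4 + 2 * l) * (γ t).1) -
      (indexOfOmega φ l (γ t).2.2 + l) * (γ t).2.1 * (1 - (γ t).1)) = _
    ring
  hasDerivAt_Q t := by
    have h1 := hasFDerivAt_snd.comp_hasDerivAt t (hγ.hasDerivAt t)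
    exact hasFDerivAt_fst.comp_hasDerivAt t h1
  hasDerivAt_Ω t := by
    have h1 := hasFDerivAt_snd.comp_hasDerivAt t (hγ.hasDerivAt t)
    exact hasFDerivAt_snd.comp_hasDerivAt t h1

lemma mapClusterPt_of_mem_omegaLimitSet {γ : ℝ → ℝ × ℝ × ℝ} {p : ℝ × ℝ × ℝ}
    (hp : p ∈ omegaLimitSet γ) : MapClusterPt p atTop γ := by
  rw [omegaLimitSet, mem_omegaLimit_iff_frequently] at hp
  refine mapClusterPt_iff_frequently.2 fun s hs => (hp s hs).mono fun t ht => ?_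
  obtain ⟨_, _, h⟩ := ht
  exact h

lemma omegaLimitSet_subset_of_tendsto {γ : ℝ → ℝ × ℝ × ℝ}
    (hQ : Tendsto (fun t => (γ t).2.1) atTop (𝓝 1))
    (hΩ : Tendsto (fun t => (γ t).2.2) atTop (𝓝 0)) :
    omegaLimitSet γ ⊆ {p | p.2.1 = 1 ∧ p.2.2 = 0} := by
  intro p hp
  have hc := mapClusterPt_of_mem_omegaLimitSet hp
  have h1 : MapClusterPt p.2.1 atTop (fun t => (γ t).2.1) :=
    hc.continuousAt_comp (f := fun p : ℝ × ℝ × ℝ => p.2.1) (by fun_prop)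
  have h2 : MapClusterPt p.2.2 atTop (fun t => (γ t).2.2) :=
    hc.continuousAt_comp (f := fun p : ℝ × ℝ × ℝ => p.2.2) (by fun_prop)
  exact ⟨eq_of_nhds_neBot (ClusterPt.mono h1 hQ), eq_of_nhds_neBot (ClusterPt.mono h2 hΩ)⟩

lemma omegaLimitSet_eq_singleton_of_tendsto {γ : ℝ → ℝ × ℝ × ℝ} {p : ℝ × ℝ × ℝ}
    (h : Tendsto γ atTop (𝓝 p)) : omegaLimitSet γ = {p} := by
  refine Subset.antisymm (fun x hx => ?_) (singleton_subset_iff.2 ?_)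
  · have hc : MapClusterPt x atTop γ := mapClusterPt_of_mem_omegaLimitSet hx
    exact eq_of_nhds_neBot (ClusterPt.mono hc h)
  · rw [omegaLimitSet, mem_omegaLimit_iff_frequently]
    exact fun s hs => (h.eventually_mem hs).frequently.mono fun t ht => ⟨(), mem_univ _, ht⟩

/-- Every orbit originating from `L₁` or `L₂` below `Ω₀` runs into the boundary edge
`Q = 1, Ω = 0`. -/
lemma IsInteriorOrbit.tendsto_Q_and_Ω {l : ℝ} (hl : -1 < l) {φ : ℝ → ℝ} (hφ : IsAdmissible l φ)
    {Ω₀ : ℝ} (hΩ₀ : Ω₀ ∈ Ioo (0 : ℝ) 1) (hle : ∀ Ω ∈ Ioc (0 : ℝ) Ω₀, indexOfOmega φ l Ω ≤ 5 + 3 * l)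
    (hne : ¬ ∀ᶠ Ω in 𝓝[>] (0 : ℝ), indexOfOmega φ l Ω = 5 + 3 * l) {γ : ℝ → ℝ × ℝ × ℝ}
    (hγ : IsInteriorOrbit φ l γ)
    (hor : OriginatesFrom γ ((L₁ ∪ L₂ l) ∩ {p | p.2.2 ≤ Ω₀})) :
    Tendsto (fun t => (γ t).2.1) atTop (𝓝 1) ∧ Tendsto (fun t => (γ t).2.2) atTop (𝓝 0) := by
  have h := hγ.isCoordOrbit
  have ha : 1 < 3 + 2 * l := by linarith
  obtain ⟨p, ⟨hp, hpΩ⟩, hlim⟩ := hor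
  have hlimU : Tendsto (fun t => (γ t).1) atBot (𝓝 p.1) := hlim.fst_nhds
  have hlimQ : Tendsto (fun t => (γ t).2.1) atBot (𝓝 p.2.1) := hlim.snd_nhds.fst_nhds
  have hlimΩ : Tendsto (fun t => (γ t).2.2) atBot (𝓝 p.2.2) := hlim.snd_nhds.snd_nhds
  have hΩle : ∀ t, (γ t).2.2 ≤ Ω₀ := fun t => (h.antitone_Ω.ge_of_tendsto hlimΩ t).trans hpΩ
  have hp1 : p.1 = 1 ∨ p.1 = (3 + 2 * l) / (3 + 2 * l + 1) :=
    hp.imp (fun h => h.1) fun h => by rw [h.1]; ring_nf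
  have hp2 : p.2.1 = 0 := by rcases hp with hp | hp <;> exact hp.2.1
  rw [hp2] at hlimQ
  have hN : ∀ t, indexOfOmega φ l (γ t).2.2 + l ≤ 2 * (3 + 2 * l) - 1 := fun t => by
    linarith [hle _ ⟨(h.Ω_mem t).1, hΩle t⟩]
  have hW := h.criticalLevel_nonneg (by linarith) hN hp1 hlimU hlimQ
  have hΩ : Tendsto (fun t => (γ t).2.2) atTop (𝓝 0) := by
    refine h.tendsto_Ω (by linarith) (h.monotone_Q ha hW) fun α hα => ?_
    rcases le_or_gt α Ω₀ with hαΩ | hαΩ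
    · obtain ⟨M, hM⟩ := hφ.exists_le_indexOfOmega hl hα hαΩ hΩ₀.2
      exact ⟨M, fun t ht => hM _ ⟨ht, hΩle t⟩⟩
    · exact ⟨0, fun t ht => absurd (ht.trans (hΩle t)) hαΩ.not_ge⟩
  refine ⟨h.tendsto_Q ha hN hW (h.exists_criticalLevel_pos (by linarith) hW ?_), hΩ⟩
  -- As `Ω` decreases continuously to `0`, the orbit sees every value of the index near `0`.
  by_contra! hcon
  refine hne ?_
  have hcont : Continuous fun t => (γ t).2.2 :=
    continuous_iff_continuousAt.2 fun t => (h.hasDerivAt_Ω t).continuousAt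
  filter_upwards [Ioo_mem_nhdsGT (h.Ω_mem 0).1] with x hx
  obtain ⟨s, hs⟩ := (hΩ.eventually_lt_const hx.1).exists
  obtain ⟨t, rfl⟩ := mem_range_of_exists_le_of_exists_ge hcont ⟨s, hs.le⟩ ⟨0, hx.2.le⟩
  linarith [hcon t]

end StaticVlasovPoisson

theorem proposition3
    (l : ℝ) (hl : -1 < l)
    (φ : ℝ → ℝ) (hφ : StaticVlasovPoisson.IsAdmissible l φ)
    (Ω₀ : ℝ) (hΩ₀ : Ω₀ ∈ Ioo (0 : ℝ) 1)
    (hle : ∀ Ω ∈ Ioc (0 : ℝ) Ω₀, StaticVlasovPoisson.indexOfOmega φ l Ω ≤ 5 + 3 * l)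
    (hne : ¬ ∀ᶠ Ω in 𝓝[>] (0 : ℝ), StaticVlasovPoisson.indexOfOmega φ l Ω = 5 + 3 * l) :
    (∀ γ : ℝ → ℝ × ℝ × ℝ, StaticVlasovPoisson.IsInteriorOrbit φ l γ →
      StaticVlasovPoisson.OriginatesFrom γ
        ((StaticVlasovPoisson.L₁ ∪ StaticVlasovPoisson.L₂ l) ∩ {p | p.2.2 ≤ Ω₀}) →
      StaticVlasovPoisson.omegaLimitSet γ ⊆ {p | p.2.1 = 1 ∧ p.2.2 = 0}) ∧
    ((∃ ε > 0, ∀ᶠ Ω in 𝓝[>] (0 : ℝ), -l + ε ≤ StaticVlasovPoisson.indexOfOmega φ l Ω) →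
      ∀ γ : ℝ → ℝ × ℝ × ℝ, StaticVlasovPoisson.IsInteriorOrbit φ l γ →
        StaticVlasovPoisson.OriginatesFrom γ
          ((StaticVlasovPoisson.L₁ ∪ StaticVlasovPoisson.L₂ l) ∩ {p | p.2.2 ≤ Ω₀}) →
        StaticVlasovPoisson.omegaLimitSet γ = {(0, 1, 0)}) := by
  refine ⟨fun γ hγ hor => ?_, fun ⟨ε, hε, hlow⟩ γ hγ hor => ?_⟩
  · obtain ⟨hQ, hΩ⟩ := hγ.tendsto_Q_and_Ω hl hφ hΩ₀ hle hne hor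
    exact StaticVlasovPoisson.omegaLimitSet_subset_of_tendsto hQ hΩ
  · obtain ⟨hQ, hΩ⟩ := hγ.tendsto_Q_and_Ω hl hφ hΩ₀ hle hne hor
    have h := hγ.isCoordOrbit
    have hΩ' : Tendsto (fun t => (γ t).2.2) atTop (𝓝[>] 0) :=
      tendsto_nhdsWithin_iff.2 ⟨hΩ, Eventually.of_forall fun t => (h.Ω_mem t).1⟩
    have hU := h.tendsto_U hQ hε ((hΩ'.eventually hlow).mono fun t ht => by linarith)
    exact StaticVlasovPoisson.omegaLimitSet_eq_singleton_of_tendsto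
      (hU.prodMk_nhds (hQ.prodMk_nhds hΩ))
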